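/- All rings are unital, and modules are left modules unless stated otherwise. A ring $R$ that is left and right noetherian and has finite left and right injective dimension as a module over itself is \emph{Auslander-Gorenstein} if, for every finitely generated left or right $R$-module $L$, every $j\ge 0$ and every submodule $P\subseteq \operatorname{Ext}^j_R(L,R)$, one has $\operatorname{Ext}^i_R(P,R)=0$ for all $i<j$; it is \emph{Auslander-regular} if in addition it has finite global dimension. The grade of an $R$-module $L$ is $j_R(L)=\min\{j : \operatorname{Ext}^j_R(L,R)\neq 0\}$. For $p\in\mathbb{N}$, the module $L$ is \emph{$p$-CM} if $\operatorname{Ext}^i_R(L,R)=0$ for all $i\neq p$, and \emph{CM} if it is $p$-CM for some $p\in\mathbb N$. An algebra $R$ over a field $k$ with finite Gelfand-Kirillov dimension is \emph{CM} if $j_R(L)+\operatorname{GKdim}(L)=\operatorname{GKdim}(R)$ for all nonzero finitely generated left or right $R$-modules $L$. Let $k$ be a field, let $S$ be a $k$-algebra that is Auslander-regular and CM, and let $A$ be a $k$-algebra that is Auslander-Gorenstein and CM. Let $n,m\in\mathbb{N}$. Let $N$ be a finitely generated left $A$-module that is CM and has projective dimension $n$ (so that $N$ is $n$-CM), and let $M$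 be an $(S,A)$-bimodule that is finitely generated and $m$-CM as a left $S$-module. Assume that $$\operatorname{Ext}^i_S(\operatorname{Tor}_j^A(M,N),S)=0\qquad\text{for all } j\ge 0 \text{ and all } i\neq n+m .$$ Then: (1) there is an isomorphism of right $S$-modules $$\operatorname{Ext}^{n+m}_S(M\otimes_A N,S)\;\cong\;\operatorname{Ext}^n_A(N,A)\otimes_A\operatorname{Ext}^m_S(M,S);$$ (2) $\operatorname{Tor}_i^A(M,N)=0$ for all $i>0$. -/

import Mathlib

open CategoryTheory
open MulOpposite (op)
open scoped TensorProduct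

universe u v

/-! Throughout, a left `R`-module is a `Module R L`, a right `R`-module is a `Module Rᵐᵒᵖ L`, and an
`(S, A)`-bimodule carries `Module S M`, `Module Aᵐᵒᵖ M` and `SMulCommClass S Aᵐᵒᵖ M`. -/

/-! ### The tensor product over a noncommutative ring -/

/-- The subgroup of `M ⊗[ℤ] N` generated by all `(x • a) ⊗ y - x ⊗ (a • y)`. -/
def balancedRel (A : Type*) [Ring A] (M : Type*) [AddCommGroup M] [Module Aᵐᵒᵖ M]
    (N : Type*) [AddCommGroup N] [Module A N] : AddSubgroup (M ⊗[ℤ] N) :=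
  AddSubgroup.closure
    {z | ∃ (x : M) (a : A) (y : N), z = (op a • x) ⊗ₜ[ℤ] y - x ⊗ₜ[ℤ] (a • y)}

/-- The tensor product `M ⊗_A N` of a right `A`-module `M` and a left `A`-module `N`. -/
def BalancedTensor (A : Type*) [Ring A] (M : Type*) [AddCommGroup M] [Module Aᵐᵒᵖ M]
    (N : Type*) [AddCommGroup N] [Module A N] :=
  (M ⊗[ℤ] N) ⧸ balancedRel A M N

namespace BalancedTensor

section

variable (A : Type*) [Ring A] (M : Type*) [AddCommGroup M] [Module Aᵐᵒᵖ M]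
  (N : Type*) [AddCommGroup N] [Module A N]

noncomputable instance : AddCommGroup (BalancedTensor A M N) :=
  inferInstanceAs (AddCommGroup ((M ⊗[ℤ] N) ⧸ balancedRel A M N))

variable {M N}

/-- The class `x ⊗ y` of a pure tensor. -/
noncomputable def tmul (x : M) (y : N) : BalancedTensor A M N :=
  QuotientAddGroup.mk (x ⊗ₜ[ℤ] y)

variable {A}

theorem tmul_add (x : M) (y y' : N) : tmul A x (y + y') = tmul A x y + tmul A x y' := by
  unfold tmul; rw [TensorProduct.tmul_add]; rfl

theorem add_tmul (x x' : M) (y : N) : tmul A (x + x') y = tmul A x y + tmul A x' y := by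
  unfold tmul; rw [TensorProduct.add_tmul]; rfl

theorem op_smul_tmul (x : M) (a : A) (y : N) : tmul A (op a • x) y = tmul A x (a • y) :=
  (QuotientAddGroup.eq_iff_sub_mem).2 (AddSubgroup.subset_closure ⟨x, a, y, rfl⟩)

theorem induction {p : BalancedTensor A M N → Prop} (h0 : p 0) (ht : ∀ x y, p (tmul A x y))
    (ha : ∀ z w, p z → p w → p (z + w)) (z : BalancedTensor A M N) : p z := by
  obtain ⟨z, rfl⟩ := QuotientAddGroup.mk_surjective z
  induction z using TensorProduct.induction_on with
  | zero => exact h0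
  | tmul x y => exact ht x y
  | add z w hz hw => exact ha _ _ hz hw

theorem hom_ext {G : Type*} [AddCommGroup G] {f g : BalancedTensor A M N →+ G}
    (h : ∀ x y, f (tmul A x y) = g (tmul A x y)) : f = g := by
  ext z
  induction z using BalancedTensor.induction with
  | h0 => simp
  | ht x y => exact h x y
  | ha z w hz hw => simp [hz, hw]

variable {M' : Type*} [AddCommGroup M'] [Module Aᵐᵒᵖ M'] {N' : Type*} [AddCommGroup N'] [Module A N']
  {M'' : Type*} [AddCommGroup M''] [Module Aᵐᵒᵖ M'']
  {N'' : Type*} [AddCommGroup N''] [Module A N'']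

/-- The additive map `f ⊗ g`. -/
noncomputable def map (f : M →ₗ[Aᵐᵒᵖ] M') (g : N →ₗ[A] N') :
    BalancedTensor A M N →+ BalancedTensor A M' N' :=
  QuotientAddGroup.map (balancedRel A M N) (balancedRel A M' N')
    (TensorProduct.map f.toAddMonoidHom.toIntLinearMap
      g.toAddMonoidHom.toIntLinearMap).toAddMonoidHom (by
      refine (AddSubgroup.closure_le _).2 ?_
      rintro _ ⟨x, a, y, rfl⟩
      refine AddSubgroup.subset_closure ⟨f x, a, g y, ?_⟩
      rw [map_sub]
      exact congrArg₂ (fun p q => p ⊗ₜ[ℤ] g y - f x ⊗ₜ[ℤ] q) (f.map_smul (op a) x)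
        (g.map_smul a y))

@[simp]
theorem map_tmul (f : M →ₗ[Aᵐᵒᵖ] M') (g : N →ₗ[A] N') (x : M) (y : N) :
    map f g (tmul A x y) = tmul A (f x) (g y) := rfl

theorem map_id : map (A := A) (LinearMap.id : M →ₗ[Aᵐᵒᵖ] M) (LinearMap.id : N →ₗ[A] N) =
    AddMonoidHom.id _ := hom_ext fun _ _ => rfl

theorem map_comp_apply (f : M →ₗ[Aᵐᵒᵖ] M') (g : N →ₗ[A] N') (f' : M' →ₗ[Aᵐᵒᵖ] M'')
    (g' : N' →ₗ[A] N'') (z : BalancedTensor A M N) :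
    map f' g' (map f g z) = map (f' ∘ₗ f) (g' ∘ₗ g) z :=
  DFunLike.congr_fun (f := (map f' g').comp (map f g)) (g := map (f' ∘ₗ f) (g' ∘ₗ g))
    (hom_ext fun _ _ => rfl) z

theorem map_add_left (f f' : M →ₗ[Aᵐᵒᵖ] M') (g : N →ₗ[A] N') :
    map (f + f') g = map f g + map f' g :=
  hom_ext fun _ _ => add_tmul _ _ _

theorem map_add_right (f : M →ₗ[Aᵐᵒᵖ] M') (g g' : N →ₗ[A] N') :
    map f (g + g') = map f g + map f g' :=
  hom_ext fun _ _ => tmul_add _ _ _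

theorem map_zero_left (g : N →ₗ[A] N') : map (0 : M →ₗ[Aᵐᵒᵖ] M') g = 0 := by
  have h := map_add_left (0 : M →ₗ[Aᵐᵒᵖ] M') 0 g
  simpa using h

theorem map_zero_right (f : M →ₗ[Aᵐᵒᵖ] M') : map f (0 : N →ₗ[A] N') = 0 := by
  have h := map_add_right f (0 : N →ₗ[A] N') 0
  simpa using h

end

section Modules

variable (T A : Type*) [Ring T] [Ring A] (M : Type*) [AddCommGroup M] [Module Aᵐᵒᵖ M]
  (N : Type*) [AddCommGroup N] [Module A N]

/-- The action on `M ⊗_A N` induced by an action on `M`: `t • (x ⊗ y) = (t • x) ⊗ y`. -/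
noncomputable abbrev leftModule [Module T M] [SMulCommClass T Aᵐᵒᵖ M] :
    Module T (BalancedTensor A M N) where
  smul t z := map (DistribSMul.toLinearMap Aᵐᵒᵖ M t) LinearMap.id z
  one_smul z := by
    change map (DistribSMul.toLinearMap Aᵐᵒᵖ M (1 : T)) LinearMap.id z = z
    rw [show DistribSMul.toLinearMap Aᵐᵒᵖ M (1 : T) = LinearMap.id by ext; simp, map_id]; rfl
  mul_smul s t z := by
    change map _ _ z = map _ _ (map _ _ z)
    rw [map_comp_apply]; congr 2; ext; simp [mul_smul]
  smul_zero t := _root_.map_zero _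
  smul_add t z w := _root_.map_add _ z w
  add_smul s t z := by
    change map _ _ z = map _ _ z + map _ _ z
    rw [← AddMonoidHom.add_apply, ← map_add_left]; congr 2; ext; simp [add_smul]
  zero_smul z := by
    change map (DistribSMul.toLinearMap Aᵐᵒᵖ M (0 : T)) LinearMap.id z = 0
    rw [show DistribSMul.toLinearMap Aᵐᵒᵖ M (0 : T) = 0 by ext; simp, map_zero_left]; rfl

/-- The action on `M ⊗_A N` induced by an action on `N`: `t • (x ⊗ y) = x ⊗ (t • y)`. -/
noncomputable abbrev rightModule [Module T N] [SMulCommClass T A N] :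
    Module T (BalancedTensor A M N) where
  smul t z := map LinearMap.id (DistribSMul.toLinearMap A N t) z
  one_smul z := by
    change map LinearMap.id (DistribSMul.toLinearMap A N (1 : T)) z = z
    rw [show DistribSMul.toLinearMap A N (1 : T) = LinearMap.id by ext; simp, map_id]; rfl
  mul_smul s t z := by
    change map _ _ z = map _ _ (map _ _ z)
    rw [map_comp_apply]; congr 2; ext; simp [mul_smul]
  smul_zero t := _root_.map_zero _
  smul_add t z w := _root_.map_add _ z w
  add_smul s t z := by
    change map _ _ z = map _ _ z + map _ _ z
    rw [← AddMonoidHom.add_apply, ← map_add_right]; congr 2; ext; simp [add_smul]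
  zero_smul z := by
    change map LinearMap.id (DistribSMul.toLinearMap A N (0 : T)) z = 0
    rw [show DistribSMul.toLinearMap A N (0 : T) = 0 by ext; simp, map_zero_right]; rfl

end Modules

end BalancedTensor

/-! ### Tor as a left module -/

section Tor

variable (S A : Type u) [Ring S] [Ring A] (M : Type u) [AddCommGroup M] [Module S M]
  [Module Aᵐᵒᵖ M] [SMulCommClass S Aᵐᵒᵖ M]

/-- `M ⊗_A N` as a left `S`-module. -/
noncomputable def bimoduleTensorObj (N : ModuleCat.{u} A) : ModuleCat.{u} S :=
  letI := BalancedTensor.leftModule S A M N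
  ModuleCat.of S (BalancedTensor A M N)

variable {A} in
/-- The `S`-linear map `id ⊗ g`. -/
noncomputable def bimoduleTensorMap {N N' : ModuleCat.{u} A} (g : N ⟶ N') :
    bimoduleTensorObj S A M N ⟶ bimoduleTensorObj S A M N' :=
  letI := BalancedTensor.leftModule S A M N
  letI := BalancedTensor.leftModule S A M N'
  ModuleCat.ofHom
    { toFun := BalancedTensor.map LinearMap.id g.hom
      map_add' := _root_.map_add _
      map_smul' := fun s z => by
        change BalancedTensor.map _ _ (BalancedTensor.map _ _ z) =
          BalancedTensor.map _ _ (BalancedTensor.map _ _ z)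
        rw [BalancedTensor.map_comp_apply, BalancedTensor.map_comp_apply]; rfl }

/-- The functor `M ⊗_A -` from left `A`-modules to left `S`-modules, for an `(S, A)`-bimodule. -/
noncomputable def bimoduleTensor : ModuleCat.{u} A ⥤ ModuleCat.{u} S where
  obj N := bimoduleTensorObj S A M N
  map g := bimoduleTensorMap S M g
  map_id N := ModuleCat.hom_ext <| LinearMap.ext fun z =>
    DFunLike.congr_fun (BalancedTensor.map_id (A := A) (M := M) (N := N)) z
  map_comp g g' := ModuleCat.hom_ext <| LinearMap.ext fun z =>
    (BalancedTensor.map_comp_apply LinearMap.id g.hom LinearMap.id g'.hom z).symm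

instance : (bimoduleTensor S A M).Additive where
  map_add {_ _ g g'} := ModuleCat.hom_ext <| LinearMap.ext fun z =>
    DFunLike.congr_fun
      (BalancedTensor.map_add_right (LinearMap.id : M →ₗ[Aᵐᵒᵖ] M) g.hom g'.hom) z

/-- `Tor_j^A(M, N)` as a left `S`-module, for an `(S, A)`-bimodule `M` and a left `A`-module `N`. -/
noncomputable def bimoduleTor (j : ℕ) (N : Type u) [AddCommGroup N] [Module A N] : ModuleCat.{u} S :=
  ((bimoduleTensor S A M).leftDerived j).obj (ModuleCat.of A N)

end Tor

/-! ### The modules `Ext^j_R(L, R)` -/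

/-- `Ext^j_R(L, R)` for a left `R`-module `L`. -/
def ExtDual (R : Type u) [Ring R] (L : Type u) [AddCommGroup L] [Module R L] (j : ℕ) : Type u :=
  Abelian.Ext.{u} (ModuleCat.of R L) (ModuleCat.of R R) j

namespace ExtDual

open Abelian

variable (R : Type u) [Ring R] (L : Type u) [AddCommGroup L] [Module R L] (j : ℕ)

noncomputable instance : AddCommGroup (ExtDual R L j) :=
  inferInstanceAs (AddCommGroup (Ext.{u} (ModuleCat.of R L) (ModuleCat.of R R) j))

/-- The action of an operator commuting with `R`, as a morphism of left `R`-modules. -/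
def smulHom {T : Type*} [Ring T] (X : Type u) [AddCommGroup X] [Module R X] [Module T X]
    [SMulCommClass T R X] (t : T) : ModuleCat.of R X ⟶ ModuleCat.of R X :=
  ModuleCat.ofHom (DistribSMul.toLinearMap R X t)

section

variable {T : Type*} [Ring T] (X : Type u) [AddCommGroup X] [Module R X] [Module T X]
    [SMulCommClass T R X]

theorem smulHom_one : smulHom R X (1 : T) = 𝟙 _ := by ext; simp [smulHom]

theorem smulHom_mul (s t : T) : smulHom R X (s * t) = smulHom R X t ≫ smulHom R X s := by
  ext; simp [smulHom, mul_smul]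

theorem smulHom_zero : smulHom R X (0 : T) = 0 := by ext; simp [smulHom]

theorem smulHom_add (s t : T) : smulHom R X (s + t) = smulHom R X s + smulHom R X t := by
  ext; simp [smulHom, add_smul]

end

/-- The right `R`-module structure on `Ext^j_R(L, R)`: an element `r` acts by functoriality in the
second variable, through the left `R`-linear map `R → R`, `x ↦ x * r`. -/
noncomputable abbrev extRightModule :
    Module Rᵐᵒᵖ (Ext.{u} (ModuleCat.of R L) (ModuleCat.of R R) j) where
  smul r x := x.comp (Ext.mk₀ (smulHom R R r)) (add_zero j)
  one_smul x := by
    change x.comp (Ext.mk₀ (smulHom R R 1)) (add_zero j) = x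
    rw [smulHom_one, Ext.comp_mk₀_id]
  mul_smul r s x := by
    change x.comp (Ext.mk₀ (smulHom R R (r * s))) (add_zero j) =
      (x.comp (Ext.mk₀ (smulHom R R s)) (add_zero j)).comp
        (Ext.mk₀ (smulHom R R r)) (add_zero j)
    rw [smulHom_mul, ← Ext.mk₀_comp_mk₀, Ext.comp_assoc_of_third_deg_zero]
  smul_zero r := Ext.zero_comp _ _ _ _ _
  smul_add r x y := Ext.add_comp _ _ _ _
  add_smul r s x := by
    change x.comp (Ext.mk₀ (smulHom R R (r + s))) (add_zero j) = _
    rw [smulHom_add, Ext.mk₀_add, Ext.comp_add]; rfl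
  zero_smul x := by
    change x.comp (Ext.mk₀ (smulHom R R 0)) (add_zero j) = _
    rw [smulHom_zero, Ext.mk₀_zero, Ext.comp_zero]

noncomputable instance : Module Rᵐᵒᵖ (ExtDual R L j) := extRightModule R L j

variable (B : Type*) [Ring B] [Module Bᵐᵒᵖ L]

/-- The left `B`-module structure on `Ext^j_R(L, R)` for an `(R, B)`-bimodule `L`: an element `b` acts
by functoriality in the first variable, through the left `R`-linear map `L → L`, `x ↦ x * b`. -/
noncomputable abbrev extLeftModule [SMulCommClass Bᵐᵒᵖ R L] :
    Module B (Ext.{u} (ModuleCat.of R L) (ModuleCat.of R R) j) where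
  smul b x := (Ext.mk₀ (smulHom R L (op b))).comp x (zero_add j)
  one_smul x := by
    change (Ext.mk₀ (smulHom R L (op (1 : B)))).comp x (zero_add j) = x
    rw [MulOpposite.op_one, smulHom_one, Ext.mk₀_id_comp]
  mul_smul b c x := by
    change (Ext.mk₀ (smulHom R L (op (b * c)))).comp x (zero_add j) =
      (Ext.mk₀ (smulHom R L (op b))).comp
        ((Ext.mk₀ (smulHom R L (op c))).comp x (zero_add j)) (zero_add j)
    rw [MulOpposite.op_mul, smulHom_mul, Ext.mk₀_comp_mk₀_assoc]
  smul_zero b := Ext.comp_zero _ _ _ _ _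
  smul_add b x y := Ext.comp_add _ _ _ _
  add_smul b c x := by
    change (Ext.mk₀ (smulHom R L (op (b + c)))).comp x (zero_add j) = _
    rw [MulOpposite.op_add, smulHom_add, Ext.mk₀_add, Ext.add_comp]; rfl
  zero_smul x := by
    change (Ext.mk₀ (smulHom R L (op (0 : B)))).comp x (zero_add j) = _
    rw [MulOpposite.op_zero, smulHom_zero, Ext.mk₀_zero, Ext.zero_comp]

variable [SMulCommClass R Bᵐᵒᵖ L]

noncomputable instance : Module B (ExtDual R L j) :=
  haveI : SMulCommClass Bᵐᵒᵖ R L := SMulCommClass.symm _ _ _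
  extLeftModule R L j B

instance : SMulCommClass Rᵐᵒᵖ B (ExtDual R L j) where
  smul_comm r b x := by
    have : SMulCommClass Bᵐᵒᵖ R L := SMulCommClass.symm _ _ _
    exact Ext.comp_assoc_of_third_deg_zero (Ext.mk₀ (smulHom R L (op b)))
      (x : Ext.{u} (ModuleCat.of R L) (ModuleCat.of R R) j) (Ext.mk₀ (smulHom R R r)) (zero_add j)

end ExtDual

/-! ### Auslander-Gorenstein rings, grade and Cohen-Macaulay modules -/

section Rings

variable (R : Type u) [Ring R]

/-- For every finitely generated left `R`-module `L` and every (right) submodule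
`P ⊆ Ext^j_R(L, R)`, one has `Ext^i_R(P, R) = 0` for all `i < j`. -/
def LeftAuslanderCondition : Prop :=
  ∀ (L : Type u) [AddCommGroup L] [Module R L], Module.Finite R L →
    ∀ (j : ℕ) (P : Submodule Rᵐᵒᵖ (ExtDual R L j)), ∀ i < j, Subsingleton (ExtDual Rᵐᵒᵖ P i)

/-- Auslander-Gorenstein rings. Right `R`-modules are left `Rᵐᵒᵖ`-modules, so each right-hand
condition is the left-hand one for `Rᵐᵒᵖ`. -/
structure IsAuslanderGorenstein : Prop where
  noetherian_left : IsNoetherianRing R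
  noetherian_right : IsNoetherianRing Rᵐᵒᵖ
  injdim_left : injectiveDimension (ModuleCat.of R R) < ⊤
  injdim_right : injectiveDimension (ModuleCat.of Rᵐᵒᵖ Rᵐᵒᵖ) < ⊤
  auslander_left : LeftAuslanderCondition R
  auslander_right : LeftAuslanderCondition Rᵐᵒᵖ

/-- The left global dimension of `R` is finite. -/
def FiniteLeftGlobalDimension : Prop :=
  ∃ d : ℕ, ∀ X : ModuleCat.{u} R, projectiveDimension X ≤ d

/-- Auslander-regular rings. -/
structure IsAuslanderRegular : Prop extends IsAuslanderGorenstein R where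
  gldim_left : FiniteLeftGlobalDimension R
  gldim_right : FiniteLeftGlobalDimension Rᵐᵒᵖ

variable (L : Type u) [AddCommGroup L] [Module R L]

/-- The grade `j_R(L)`, the least `j` with `Ext^j_R(L, R) ≠ 0` (and `⊤` if there is none). -/
noncomputable def moduleGrade : ℕ∞ :=
  ⨅ (j : ℕ) (_ : Nontrivial (ExtDual R L j)), (j : ℕ∞)

/-- `L` is `p`-Cohen-Macaulay: `Ext^i_R(L, R) = 0` for all `i ≠ p`. -/
def IsCMOfGrade (p : ℕ) : Prop :=
  ∀ i : ℕ, i ≠ p → Subsingleton (ExtDual R L i)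

end Rings

/-! ### Gelfand-Kirillov dimension and Cohen-Macaulay algebras -/

section GK

variable (k : Type v) [Field k] (R : Type u) [Ring R] [Algebra k R]

/-- The Gelfand-Kirillov dimension of a left module `L` over a `k`-algebra `R`: the supremum of
`limsup log (dim_k V^n F) / log n` over the finite-dimensional subspaces `1 ∈ V ⊆ R` and `F ⊆ L`.
The zero module has dimension `-∞`. -/
noncomputable def gkDim (L : Type u) [AddCommGroup L] [Module R L] [Module k L]
    [IsScalarTower k R L] : EReal :=
  ⨆ (V : Submodule k R) (_ : Module.Finite k V) (_ : (1 : R) ∈ V)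
    (F : Submodule k L) (_ : Module.Finite k F),
    Filter.limsup (fun n : ℕ =>
      ENNReal.log (Module.finrank k (V ^ n • F : Submodule k L) : ℕ) / ENNReal.log (n : ℕ))
      Filter.atTop

/-- `j_R(L) + GKdim(L) = GKdim(R)` for all nonzero finitely generated left `R`-modules `L`. The
`k`-structure of `L` is the one given by `k → R`. -/
def LeftCMCondition : Prop :=
  ∀ (L : Type u) [AddCommGroup L] [Module R L] [Module k L] [IsScalarTower k R L],
    Module.Finite R L → Nontrivial L →
      (((moduleGrade R L : ℕ∞) : ENNReal) : EReal) + gkDim k R L = gkDim k R R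

/-- Cohen-Macaulay algebras over a field, with the condition imposed on left and right modules. -/
structure IsCMAlgebra : Prop where
  gkDim_lt_top : gkDim k R R < ⊤
  cm_left : LeftCMCondition k R
  cm_right : LeftCMCondition k Rᵐᵒᵖ

end GK

/-! Write `F = M ⊗_A -`, `E = Ext^m_S(M, S)`, `q = n + m`, and take `0 → K → P → N → 0` with `P`
finitely generated projective. Both halves are inductions on the projective dimension along such
sequences. They rest on one fact: `F P` is a direct summand of some `M^r`, so `Ext_S(F P, S)` lives
only in degree `m`.

Vanishing of `Tor` (`isZero_leftDerived_bimoduleTensor`). The bound `q` stays fixed while the bound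
`d` on the projective dimension varies. For `N` of projective dimension at most `d + 1`, with `d + 1
+ m ≤ q`, cut `0 → Tor_1(N) → F K → F P → F N → 0` at the image `I` of `F K → F P`. Since `q > m`,
the groups `Ext^i_S(I, S)` vanish for `i ≥ q`. The hypotheses pass to `K`, and induction gives
`Ext^i_S(F K, S) = 0` for `i > d + m`, in particular for `i = q`. This forces `Ext^q_S(Tor_1(N), S)
= 0`, the only degree left open by assumption. So `Tor_1(N)` is a finitely generated module with no
`Ext` into `S`, and it is zero because `S` is noetherian of finite global dimension
(`ModuleCat.isZero_of_subsingleton_extDual`). The higher `Tor` of `N` are those of `K`, shifted.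

The isomorphism (`nonempty_equiv_tensor_of_isZero_leftDerived`). Once `Tor` vanishes, `0 → F K → F P
→ F N → 0` is exact and connecting maps lower the degree on both sides, until `K` and `P` are both
projective. There the natural map `Hom_A(-, A) ⊗_A E → Ext^m_S(F -, S)` is bijective on `K` and `P`
(`homTensorExt_bijective`), and both sides of the claim are cokernels of corresponding maps
(`nonempty_equiv_tensor_of_shortExact`). -/

/-! ### Dimension shifting for left derived functors -/

section

open Limits

namespace CategoryTheory.ProjectiveResolution

variable {C : Type*} [Category* C] [Abelian C]

/-- The augmentation of a projective resolution, with target the resolved object itself. -/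
noncomputable def augmentation {X : C} (Q : ProjectiveResolution X) : Q.complex.X 0 ⟶ X := Q.π.f 0

@[simp]
theorem d_comp_augmentation {X : C} (Q : ProjectiveResolution X) :
    Q.complex.d 1 0 ≫ Q.augmentation = 0 := Q.complex_d_comp_π_f_zero

@[simp]
theorem d_comp_augmentation_assoc {X Y : C} (Q : ProjectiveResolution X) (f : X ⟶ Y) :
    Q.complex.d 1 0 ≫ Q.augmentation ≫ f = 0 := by
  rw [← Category.assoc, Q.d_comp_augmentation, zero_comp]

/-- The resolved object is the cokernel of the first differential. -/
noncomputable def isColimitAugmentation {X : C} (Q : ProjectiveResolution X) :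
    IsColimit (CokernelCofork.ofπ Q.augmentation Q.d_comp_augmentation) :=
  Q.isColimitCokernelCofork

/-- For a short exact sequence with projective middle term, a projective resolution of the first term
gives one of the last term. -/
noncomputable def splice {S : ShortComplex C} (hS : S.ShortExact) [Projective S.X₂]
    (Q : ProjectiveResolution S.X₁) : ProjectiveResolution S.X₃ where
  complex := ChainComplex.augment Q.complex (Q.augmentation ≫ S.f) (by simp)
  projective := by
    rintro (_ | i)
    · exact ‹Projective S.X₂›
    · exact Q.projective i
  π := (ChainComplex.toSingle₀Equiv _ _).symm ⟨S.g, by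
    change (Q.augmentation ≫ S.f) ≫ S.g = 0
    simp⟩
  quasiIso := by
    have := hS.mono_f
    have := hS.epi_g
    have : Epi Q.augmentation := inferInstanceAs (Epi (Q.π.f 0))
    refine ⟨fun i => ?_⟩
    match i with
    -- Exactness at the middle term `S.X₂`: the augmentation is epi, so its composite with `S.f` has
    -- the same image as `S.f`.
    | 0 =>
      rw [ChainComplex.quasiIsoAt₀_iff, ShortComplex.quasiIso_iff_of_zeros' _ rfl rfl rfl]
      let φ : ShortComplex.mk (Q.augmentation ≫ S.f) S.g (by simp) ⟶ S :=
        { τ₁ := Q.augmentation, τ₂ := 𝟙 _, τ₃ := 𝟙 _ }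
      have : Epi φ.τ₁ := this
      have : IsIso φ.τ₂ := inferInstanceAs (IsIso (𝟙 _))
      have : Mono φ.τ₃ := inferInstanceAs (Mono (𝟙 _))
      refine (ShortComplex.exact_and_epi_g_iff_of_iso ?_).2
        ⟨(ShortComplex.exact_iff_of_epi_of_isIso_of_mono φ).2 hS.exact, hS.epi_g⟩
      refine ShortComplex.isoMk (Iso.refl _) (Iso.refl _) (Iso.refl _) ?_ ?_
      · exact (Category.id_comp _).trans (Category.comp_id _).symm
      · refine (Category.id_comp _).trans ((Category.comp_id _).trans ?_).symm
        exact ChainComplex.toSingle₀Equiv_symm_apply_f_zero _ _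
    -- Exactness at `Q₀`: `S.f` is mono, so following the augmentation by `S.f` does not change its
    -- kernel.
    | 1 =>
      rw [quasiIsoAt_iff_exactAt' _ _ (ChainComplex.exactAt_succ_single_obj _ _)]
      rw [HomologicalComplex.exactAt_iff' _ 2 1 0 (by simp) (by simp)]
      let φ : ShortComplex.mk _ _ Q.d_comp_augmentation ⟶
          ShortComplex.mk (Q.complex.d 1 0) (Q.augmentation ≫ S.f) (by simp) :=
        { τ₁ := 𝟙 _, τ₂ := 𝟙 _, τ₃ := S.f }
      have : Epi φ.τ₁ := inferInstanceAs (Epi (𝟙 _))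
      have : IsIso φ.τ₂ := inferInstanceAs (IsIso (𝟙 _))
      have : Mono φ.τ₃ := hS.mono_f
      exact (ShortComplex.exact_iff_of_epi_of_isIso_of_mono φ).1
        (ShortComplex.exact_of_g_is_cokernel _ Q.isColimitAugmentation)
    | (i + 2) =>
      rw [quasiIsoAt_iff_exactAt' _ _ (ChainComplex.exactAt_succ_single_obj _ _)]
      rw [HomologicalComplex.exactAt_iff' _ (i + 3) (i + 2) (i + 1) (by simp) (by simp)]
      exact Q.exact_succ i

end CategoryTheory.ProjectiveResolution

/-- The homology of `X₁ ⟶ X₂ ⟶ X₃` is the kernel of the induced map from the cokernel of the first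
map. -/
noncomputable def CategoryTheory.ShortComplex.homologyIsoKernelOfIsCokernel {D : Type*} [Category* D]
    [Abelian D] (T : ShortComplex D) {Q : D} (p : T.X₂ ⟶ Q) (wp : T.f ≫ p = 0)
    (hp : IsColimit (CokernelCofork.ofπ p wp)) (h : Q ⟶ T.X₃) (w : p ≫ h = T.g) :
    T.homology ≅ kernel h :=
  have hdesc : hp.desc (CokernelCofork.ofπ _ T.zero) = h :=
    Cofork.IsColimit.hom_ext hp ((hp.fac _ WalkingParallelPair.one).trans w.symm)
  letI data : T.RightHomologyData :=
    { Q := Q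
      H := kernel h
      p := p
      ι := kernel.ι h
      wp := wp
      hp := hp
      wι := by rw [hdesc]; exact kernel.condition h
      hι := KernelFork.isLimitOfIsLimitOfIff' (kernelIsKernel h) _ fun _ φ => by rw [hdesc] }
  data.homologyIso

namespace CategoryTheory.Functor
variable {C : Type*} [Category* C] [Abelian C] {D : Type*} [Category* D] [Abelian D]
  [EnoughProjectives C]

/-- Dimension shifting for left derived functors. -/
noncomputable def leftDerivedShiftIso (F : C ⥤ D) [F.Additive] {S : ShortComplex C}
    (hS : S.ShortExact) [Projective S.X₂] (j : ℕ) :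
    (F.leftDerived (j + 2)).obj S.X₃ ≅ (F.leftDerived (j + 1)).obj S.X₁ :=
  letI Q := projectiveResolution S.X₁
  -- The spliced complex is `Q` moved up one degree with `S.X₂` put in degree `0`. Around degree `j
  -- + 2` it is therefore literally `Q` around degree `j + 1`; degree `1` is excluded because its
  -- outgoing differential is the new one.
  (Q.splice hS).isoLeftDerivedObj F (j + 2) ≪≫
    HomologicalComplex.homologyIsoSc' _ (j + 3) (j + 2) (j + 1) (by simp) (by simp) ≪≫
    (HomologicalComplex.homologyIsoSc' ((F.mapHomologicalComplex _).obj Q.complex)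
      (j + 2) (j + 1) j (by simp) (by simp)).symm ≪≫
    (Q.isoLeftDerivedObj F (j + 1)).symm

/-- Dimension shifting for left derived functors, in the lowest degree. -/
noncomputable def leftDerivedOneIso (F : C ⥤ D) [F.Additive] [PreservesFiniteColimits F]
    {S : ShortComplex C} (hS : S.ShortExact) [Projective S.X₂] :
    (F.leftDerived 1).obj S.X₃ ≅ Limits.kernel (F.map S.f) :=
  letI Q := projectiveResolution S.X₁
  have h₁ : F.map (Q.complex.d 1 0) ≫ F.map Q.augmentation = 0 := by rw [← F.map_comp]; simp
  have h₂ : F.map (Q.complex.d 1 0) ≫ F.map (Q.augmentation ≫ S.f) = 0 := by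
    rw [← F.map_comp]; simp
  letI e : ((F.mapHomologicalComplex _).obj (Q.splice hS).complex).sc' 2 1 0 ≅
      ShortComplex.mk _ _ h₂ :=
    ShortComplex.isoMk (Iso.refl _) (Iso.refl _) (Iso.refl _)
      ((Category.id_comp _).trans (Category.comp_id _).symm)
      ((Category.id_comp _).trans (Category.comp_id _).symm)
  (Q.splice hS).isoLeftDerivedObj F 1 ≪≫
    HomologicalComplex.homologyIsoSc' _ 2 1 0 (by simp) (by simp) ≪≫
    ShortComplex.homologyMapIso e ≪≫
    -- By right exactness `F X₁` is the cokernel of `F Q₁ → F Q₀`, so the homology at `F Q₀` is the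
    -- kernel of `F X₁ → F X₂`.
    ShortComplex.homologyIsoKernelOfIsCokernel (ShortComplex.mk _ _ h₂) (F.map Q.augmentation) h₁
      (CokernelCofork.mapIsColimit _ Q.isColimitAugmentation F) (F.map S.f) (F.map_comp _ _).symm

end CategoryTheory.Functor

end

/-! ### Right exactness of the tensor product -/

namespace BalancedTensor

variable {A : Type*} [Ring A] {M : Type*} [AddCommGroup M] [Module Aᵐᵒᵖ M]
  {N : Type*} [AddCommGroup N] [Module A N]

/-- The additive map on `M ⊗_A N` induced by a balanced biadditive map. -/
noncomputable def lift {G : Type*} [AddCommGroup G] (φ : M →+ N →+ G)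
    (h : ∀ (x : M) (a : A) (y : N), φ (op a • x) y = φ x (a • y)) : BalancedTensor A M N →+ G :=
  QuotientAddGroup.lift (balancedRel A M N) (TensorProduct.liftAddHom φ (fun r x y => by simp))
    ((AddSubgroup.closure_le _).2 (by
      rintro _ ⟨x, a, y, rfl⟩
      simp [h]))

theorem tmul_sub (x : M) (y y' : N) : tmul A x (y - y') = tmul A x y - tmul A x y' := by
  rw [eq_sub_iff_add_eq, ← tmul_add, sub_add_cancel]

theorem sub_tmul (x x' : M) (y : N) : tmul A (x - x') y = tmul A x y - tmul A x' y := by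
  rw [eq_sub_iff_add_eq, ← add_tmul, sub_add_cancel]

@[simp]
theorem tmul_zero (x : M) : tmul A x (0 : N) = 0 := by
  rw [← sub_self (0 : N), tmul_sub, sub_self]

@[simp]
theorem zero_tmul (y : N) : tmul A (0 : M) y = 0 := by
  rw [← sub_self (0 : M), sub_tmul, sub_self]

variable {M' : Type*} [AddCommGroup M'] [Module Aᵐᵒᵖ M'] {N' : Type*} [AddCommGroup N'] [Module A N']
  {M'' : Type*} [AddCommGroup M''] [Module Aᵐᵒᵖ M'']
  {N'' : Type*} [AddCommGroup N''] [Module A N'']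

theorem map_id_surjective {g : N →ₗ[A] N'} (hg : Function.Surjective g) :
    Function.Surjective (map (LinearMap.id : M →ₗ[Aᵐᵒᵖ] M) g) := fun z => by
  induction z using BalancedTensor.induction with
  | h0 => exact ⟨0, _root_.map_zero _⟩
  | ht x y =>
    obtain ⟨y, rfl⟩ := hg y
    exact ⟨tmul A x y, rfl⟩
  | ha z w hz hw =>
    obtain ⟨z, rfl⟩ := hz
    obtain ⟨w, rfl⟩ := hw
    exact ⟨z + w, _root_.map_add _ _ _⟩

theorem map_left_surjective {f : M →ₗ[Aᵐᵒᵖ] M'} (hf : Function.Surjective f) :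
    Function.Surjective (map f (LinearMap.id : N →ₗ[A] N)) := fun z => by
  induction z using BalancedTensor.induction with
  | h0 => exact ⟨0, _root_.map_zero _⟩
  | ht x y =>
    obtain ⟨x, rfl⟩ := hf x
    exact ⟨tmul A x y, rfl⟩
  | ha z w hz hw =>
    obtain ⟨z, rfl⟩ := hz
    obtain ⟨w, rfl⟩ := hw
    exact ⟨z + w, _root_.map_add _ _ _⟩

/-- Modulo the image of `id ⊗ f`, the class of `x ⊗ y` depends only on `x` and `g y`. Hence `(x, g
y) ↦ x ⊗ y` is a well-defined balanced map, and it factors the projection onto the cokernel through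
`id ⊗ g`. -/
theorem map_id_exact {f : N →ₗ[A] N'} {g : N' →ₗ[A] N''} (hfg : Function.Exact f g)
    (hg : Function.Surjective g) :
    Function.Exact (map (LinearMap.id : M →ₗ[Aᵐᵒᵖ] M) f) (map LinearMap.id g) := by
  intro z
  constructor
  · intro hz
    let R := (map (LinearMap.id : M →ₗ[Aᵐᵒᵖ] M) f).range
    let q : BalancedTensor A M N' →+ BalancedTensor A M N' ⧸ R := QuotientAddGroup.mk' R
    have key : ∀ (x : M) (y y' : N'), g y = g y' → q (tmul A x y) = q (tmul A x y') := by
      intro x y y' h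
      obtain ⟨w, hw⟩ := (hfg (y - y')).1 (by rw [_root_.map_sub, h, sub_self])
      rw [← sub_eq_zero, ← _root_.map_sub, ← tmul_sub, ← hw]
      exact (QuotientAddGroup.eq_zero_iff _).2 ⟨tmul A x w, rfl⟩
    -- A set-theoretic section suffices: `key` restores additivity and balancedness after projecting
    -- by `q`.
    let s := Function.surjInv hg
    have hs : ∀ y, g (s y) = y := Function.surjInv_eq hg
    let φ : M →+ N'' →+ BalancedTensor A M N' ⧸ R := AddMonoidHom.mk'
      (fun x => AddMonoidHom.mk' (fun y => q (tmul A x (s y))) (fun y y' => by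
        rw [← _root_.map_add, ← tmul_add]
        exact key _ _ _ (by simp [hs]))) (fun x x' => by
        ext y
        simp [add_tmul])
    let ψ := lift (A := A) φ (fun x a y => by
      change q (tmul A (op a • x) (s y)) = q (tmul A x (s (a • y)))
      rw [op_smul_tmul]
      exact key _ _ _ (by simp [hs]))
    have hψ : ψ.comp (map LinearMap.id g) = q := hom_ext fun x y => key _ _ _ (hs _)
    have : q z = 0 := by rw [← hψ, AddMonoidHom.comp_apply, hz, _root_.map_zero]
    exact (QuotientAddGroup.eq_zero_iff z).1 this
  · rintro ⟨w, rfl⟩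
    rw [map_comp_apply, hfg.linearMap_comp_eq_zero, map_zero_right]
    rfl

theorem map_left_exact {f : M →ₗ[Aᵐᵒᵖ] M'} {g : M' →ₗ[Aᵐᵒᵖ] M''} (hfg : Function.Exact f g)
    (hg : Function.Surjective g) :
    Function.Exact (map f (LinearMap.id : N →ₗ[A] N)) (map g LinearMap.id) := by
  intro z
  constructor
  · intro hz
    let R := (map f (LinearMap.id : N →ₗ[A] N)).range
    let q : BalancedTensor A M' N →+ BalancedTensor A M' N ⧸ R := QuotientAddGroup.mk' R
    have key : ∀ (x x' : M') (y : N), g x = g x' → q (tmul A x y) = q (tmul A x' y) := by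
      intro x x' y h
      obtain ⟨w, hw⟩ := (hfg (x - x')).1 (by rw [_root_.map_sub, h, sub_self])
      rw [← sub_eq_zero, ← _root_.map_sub, ← sub_tmul, ← hw]
      exact (QuotientAddGroup.eq_zero_iff _).2 ⟨tmul A w y, rfl⟩
    let s := Function.surjInv hg
    have hs : ∀ y, g (s y) = y := Function.surjInv_eq hg
    let φ : M'' →+ N →+ BalancedTensor A M' N ⧸ R := AddMonoidHom.mk'
      (fun x => AddMonoidHom.mk' (fun y => q (tmul A (s x) y)) (fun y y' => by
        rw [← _root_.map_add, ← tmul_add])) (fun x x' => by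
        ext y
        change q _ = q _ + q _
        rw [← _root_.map_add, ← add_tmul]
        exact key _ _ _ (by simp [hs]))
    let ψ := lift (A := A) φ (fun x a y => by
      change q (tmul A (s (op a • x)) y) = q (tmul A (s x) (a • y))
      rw [← op_smul_tmul]
      exact key _ _ _ (by simp [hs]))
    have hψ : ψ.comp (map g LinearMap.id) = q := hom_ext fun x y => key _ _ _ (hs _)
    have : q z = 0 := by rw [← hψ, AddMonoidHom.comp_apply, hz, _root_.map_zero]
    exact (QuotientAddGroup.eq_zero_iff z).1 this
  · rintro ⟨w, rfl⟩
    rw [map_comp_apply, hfg.linearMap_comp_eq_zero, map_zero_left]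
    rfl

end BalancedTensor

/-! ### Right exactness, finiteness and the unit isomorphism for `M ⊗_A -`. -/

section
variable (S A : Type u) [Ring S] [Ring A] (M : Type u) [AddCommGroup M] [Module S M]
  [Module Aᵐᵒᵖ M] [SMulCommClass S Aᵐᵒᵖ M]

instance : Limits.PreservesFiniteColimits (bimoduleTensor S A M) := by
  refine ((bimoduleTensor S A M).preservesFiniteColimits_tfae.out 0 3).1 fun T hT => ?_
  have hex := (ShortComplex.ShortExact.moduleCat_exact_iff_function_exact T).1 hT.exact
  have hsurj := hT.moduleCat_surjective_g
  refine ⟨?_, ?_⟩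
  · rw [ShortComplex.ShortExact.moduleCat_exact_iff_function_exact]
    exact BalancedTensor.map_id_exact hex hsurj
  · rw [ModuleCat.epi_iff_surjective]
    exact BalancedTensor.map_id_surjective hsurj

theorem bimoduleTensor_finite [Module.Finite S M] (N : ModuleCat.{u} A) [Module.Finite A N] :
    Module.Finite S ((bimoduleTensor S A M).obj N) := by
  let := BalancedTensor.leftModule S A M N
  change Module.Finite S (BalancedTensor A M N)
  obtain ⟨s, hs⟩ := (Module.Finite.fg_top : (⊤ : Submodule S M).FG)
  obtain ⟨t, ht⟩ := (Module.Finite.fg_top : (⊤ : Submodule A N).FG)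
  refine ⟨Submodule.fg_def.2 ⟨Set.image2 (BalancedTensor.tmul A) s t,
    (s.finite_toSet.image2 _ t.finite_toSet), ?_⟩⟩
  rw [eq_top_iff]
  set W := Submodule.span S (Set.image2 (BalancedTensor.tmul A) (s : Set M) (t : Set N))
  -- The element `x` stays universally quantified during the induction on `y`, since a scalar on `y`
  -- is moved across to `x`.
  have key : ∀ (y : N) (x : M), BalancedTensor.tmul A x y ∈ W := by
    intro y
    have hy : y ∈ Submodule.span A (t : Set N) := ht ▸ Submodule.mem_top
    induction hy using Submodule.span_induction with
    | mem y hy =>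
      intro x
      have hx : x ∈ Submodule.span S (s : Set M) := hs ▸ Submodule.mem_top
      induction hx using Submodule.span_induction with
      | mem x hx => exact Submodule.subset_span ⟨x, hx, y, hy, rfl⟩
      | zero =>
        rw [BalancedTensor.zero_tmul]
        exact W.zero_mem
      | add x x' _ _ h h' =>
        rw [BalancedTensor.add_tmul]
        exact W.add_mem h h'
      | smul r x _ h => exact W.smul_mem r h
    | zero =>
      intro x
      rw [BalancedTensor.tmul_zero]
      exact W.zero_mem
    | add y y' _ _ h h' =>
      intro x
      rw [BalancedTensor.tmul_add]
      exact W.add_mem (h x) (h' x)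
    | smul a y _ h =>
      intro x
      rw [← BalancedTensor.op_smul_tmul]
      exact h _
  intro z _
  induction z using BalancedTensor.induction with
  | h0 => exact W.zero_mem
  | ht x y => exact key y x
  | ha z w hz hw => exact W.add_mem (hz trivial) (hw trivial)

/-- The isomorphism `M ⊗_A A ≅ M` of left `S`-modules. -/
noncomputable def bimoduleTensorUnit :
    (bimoduleTensor S A M).obj (ModuleCat.of A A) ≅ ModuleCat.of S M :=
  letI := BalancedTensor.leftModule S A M A
  letI f : BalancedTensor A M A →+ M := BalancedTensor.lift
    (AddMonoidHom.mk' (fun x => AddMonoidHom.mk' (fun a => op a • x) fun a b => by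
      rw [MulOpposite.op_add, add_smul]) fun x y => by ext; simp)
    (fun x a b => by simp [mul_smul])
  LinearEquiv.toModuleIso (X₁ := BalancedTensor A M A) (X₂ := M)
    { toFun := f
      map_add' := f.map_add
      map_smul' := fun r z => by
        induction z using BalancedTensor.induction with
        | h0 => simp
        | ht x a => exact (smul_comm r (op a : Aᵐᵒᵖ) x).symm
        | ha z w hz hw => rw [smul_add, f.map_add, hz, hw, f.map_add, smul_add]
      invFun := fun x => BalancedTensor.tmul A x 1
      left_inv := fun z => by
        induction z using BalancedTensor.induction with
        | h0 => simp
        | ht x a =>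
          change BalancedTensor.tmul A (op a • x) 1 = _
          rw [BalancedTensor.op_smul_tmul, smul_eq_mul, mul_one]
        | ha z w hz hw => simpa [BalancedTensor.add_tmul] using congrArg₂ (· + ·) hz hw
      right_inv := fun x => one_smul _ x }

/-- Right multiplication by `a` on `M ⊗_A A` corresponds to right multiplication by `a` on `M`. -/
theorem bimoduleTensorUnit_naturality [SMulCommClass Aᵐᵒᵖ S M] (a : Aᵐᵒᵖ) :
    (bimoduleTensor S A M).map (ExtDual.smulHom A A a) ≫ (bimoduleTensorUnit S A M).hom =
      (bimoduleTensorUnit S A M).hom ≫ ExtDual.smulHom S M a := by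
  refine ModuleCat.hom_ext (LinearMap.ext fun z => ?_)
  induction z using BalancedTensor.induction with
  | h0 => exact (map_zero _).trans (map_zero _).symm
  | ht x b =>
    change op (b * a.unop) • x = a • op b • x
    rw [← mul_smul]; rfl
  | ha z w hz hw => exact (map_add _ _ _).trans ((congrArg₂ _ hz hw).trans (map_add _ _ _).symm)

end

section

open Abelian

/-! ### The long exact sequence of `Ext(-, R)` -/

namespace ExtDual

variable {R : Type u} [Ring R]

/-- The right `R`-linear map on `Ext^j_R(-, R)` induced by a morphism. -/
noncomputable def precomp {X Y : ModuleCat.{u} R} (f : X ⟶ Y) (j : ℕ) :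
    ExtDual R Y j →ₗ[Rᵐᵒᵖ] ExtDual R X j where
  toFun x := (Ext.mk₀ f).comp (x : Ext.{u} Y (ModuleCat.of R R) j) (zero_add j)
  map_add' _ _ := Ext.comp_add _ _ _ _
  map_smul' r x := (Ext.comp_assoc_of_third_deg_zero (Ext.mk₀ f)
    (x : Ext.{u} Y (ModuleCat.of R R) j) (Ext.mk₀ (smulHom R R r)) (zero_add j)).symm

theorem precomp_id (X : ModuleCat.{u} R) (j : ℕ) (x : ExtDual R X j) : precomp (𝟙 X) j x = x :=
  Ext.mk₀_id_comp _

theorem precomp_comp {X Y Z : ModuleCat.{u} R} (f : X ⟶ Y) (g : Y ⟶ Z) (j : ℕ)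
    (x : ExtDual R Z j) : precomp (f ≫ g) j x = precomp f j (precomp g j x) :=
  (Ext.mk₀_comp_mk₀_assoc f g (x : Ext.{u} Z (ModuleCat.of R R) j)).symm

theorem precomp_add {X Y : ModuleCat.{u} R} (f g : X ⟶ Y) (j : ℕ) (x : ExtDual R Y j) :
    precomp (f + g) j x = precomp f j x + precomp g j x :=
  (congrArg (fun y : Ext.{u} X Y 0 => y.comp (x : Ext.{u} Y (ModuleCat.of R R) j) (zero_add j))
    (Ext.mk₀_add f g)).trans (Ext.add_comp _ _ _ _)

theorem precomp_sum {X Y : ModuleCat.{u} R} {ι : Type*} [Fintype ι] (f : ι → (X ⟶ Y)) (j : ℕ)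
    (x : ExtDual R Y j) : precomp (∑ i, f i) j x = ∑ i, precomp (f i) j x :=
  map_sum (AddMonoidHom.mk' (fun f : X ⟶ Y => precomp f j x) fun f g => precomp_add f g j x) f
    Finset.univ

variable {T : ShortComplex (ModuleCat.{u} R)} (hT : T.ShortExact)

/-- The connecting map `Ext^i_R(X₁, R) → Ext^j_R(X₃, R)`, `j = i + 1`, of a short exact sequence. -/
noncomputable def connecting {i j : ℕ} (h : 1 + i = j) :
    ExtDual R T.X₁ i →ₗ[Rᵐᵒᵖ] ExtDual R T.X₃ j where
  toFun x := hT.extClass.comp (x : Ext.{u} T.X₁ (ModuleCat.of R R) i) h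
  map_add' _ _ := Ext.comp_add _ _ _ _
  map_smul' r x := (Ext.comp_assoc_of_third_deg_zero hT.extClass
    (x : Ext.{u} T.X₁ (ModuleCat.of R R) i) (Ext.mk₀ (smulHom R R r)) h).symm

theorem exact_precomp_connecting {i j : ℕ} (h : 1 + i = j) :
    Function.Exact (precomp T.f i) (connecting hT h) := fun x => by
  constructor
  · intro hx
    exact Ext.contravariant_sequence_exact₁ hT _ x h hx
  · rintro ⟨y, rfl⟩
    exact hT.extClass_comp_assoc (y : Ext.{u} T.X₂ (ModuleCat.of R R) i) (h := h)

theorem connecting_surjective {i j : ℕ} (h : 1 + i = j) (h₂ : Subsingleton (ExtDual R T.X₂ j)) :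
    Function.Surjective (connecting hT h) := fun x =>
  Ext.contravariant_sequence_exact₃ hT _ x (Subsingleton.elim (α := ExtDual R T.X₂ j) _ _) h

theorem connecting_injective {i j : ℕ} (h : 1 + i = j) (h₂ : Subsingleton (ExtDual R T.X₂ i)) :
    Function.Injective (connecting hT h) := by
  rw [injective_iff_map_eq_zero]
  intro x hx
  obtain ⟨y, rfl⟩ := (exact_precomp_connecting hT h x).1 hx
  rw [Subsingleton.elim y 0, map_zero]

include hT in
theorem subsingleton_X₁ {i : ℕ} (h₂ : Subsingleton (ExtDual R T.X₂ i))
    (h₃ : Subsingleton (ExtDual R T.X₃ (i + 1))) : Subsingleton (ExtDual R T.X₁ i) :=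
  (connecting_injective hT (add_comm 1 i) h₂).subsingleton

include hT in
theorem subsingleton_X₂ {i : ℕ} (h₁ : Subsingleton (ExtDual R T.X₁ i))
    (h₃ : Subsingleton (ExtDual R T.X₃ i)) : Subsingleton (ExtDual R T.X₂ i) := by
  refine subsingleton_of_forall_eq 0 fun x => ?_
  obtain ⟨y, rfl⟩ := Ext.contravariant_sequence_exact₂ hT (ModuleCat.of R R)
    (x : Ext.{u} T.X₂ (ModuleCat.of R R) i) (Subsingleton.elim (α := ExtDual R T.X₁ i) _ _)
  rw [Subsingleton.elim (α := ExtDual R T.X₃ i) y 0]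
  exact Ext.comp_zero _ _ _ _ _

include hT in
theorem subsingleton_X₃ {i : ℕ} (h₁ : Subsingleton (ExtDual R T.X₁ i))
    (h₂ : Subsingleton (ExtDual R T.X₂ (i + 1))) : Subsingleton (ExtDual R T.X₃ (i + 1)) :=
  (connecting_surjective hT (add_comm 1 i) h₂).subsingleton

theorem subsingleton_of_iso {X Y : ModuleCat.{u} R} (e : X ≅ Y) {i : ℕ}
    (h : Subsingleton (ExtDual R X i)) : Subsingleton (ExtDual R Y i) := by
  refine subsingleton_of_forall_eq 0 fun x => ?_
  rw [← precomp_id Y i x, ← e.inv_hom_id, precomp_comp, Subsingleton.elim (precomp e.hom i x) 0,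
    map_zero]

end ExtDual

/-! ### Finitely generated projectives, and vanishing detected by `Ext(-, R)`. -/

namespace ModuleCat

variable {R : Type u} [Ring R]

/-- A dual basis of a finitely generated projective module. -/
theorem exists_dualBasis (P : ModuleCat.{u} R) [Module.Finite R P] [Projective P] :
    ∃ (r : ℕ) (f : Fin r → (P ⟶ of R R)) (p : Fin r → (of R R ⟶ P)), ∑ i, f i ≫ p i = 𝟙 P := by
  obtain ⟨r, g, f, -, -, h⟩ := Module.Finite.exists_comp_eq_id_of_projective R P
  refine ⟨r, fun i => ofHom (LinearMap.proj i ∘ₗ f),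
    fun i => ofHom (g ∘ₗ LinearMap.single R (fun _ => R) i), ?_⟩
  ext x
  rw [ModuleCat.hom_sum]
  have hx : g (f x) = x := DFunLike.congr_fun h x
  simp only [LinearMap.sum_apply]
  change ∑ i, g (Pi.single i (f x i)) = x
  rw [← map_sum, Finset.univ_sum_single, hx]

/-- A finitely generated module over a noetherian ring is the quotient of a finitely generated
projective module by a finitely generated submodule. -/
theorem exists_shortExact_finite_projective [IsNoetherianRing R] (X : ModuleCat.{u} R)
    [Module.Finite R X] :
    ∃ T : ShortComplex (ModuleCat.{u} R), T.ShortExact ∧ T.X₃ = X ∧ Module.Finite R T.X₁ ∧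
      Module.Finite R T.X₂ ∧ Projective T.X₂ := by
  obtain ⟨r, g, hg⟩ := Module.Finite.exists_fin' R X
  refine ⟨g.shortComplexKer, LinearMap.shortExact_shortComplexKer hg, rfl, ?_, ?_, ?_⟩
  · exact inferInstanceAs (Module.Finite R (LinearMap.ker g))
  · exact inferInstanceAs (Module.Finite R (Fin r → R))
  · exact inferInstanceAs (Projective (of R (Fin r → R)))

/-- A dual basis factors the identity of `P` through copies of `R`, so every class is a sum of
classes passing through `Ext^i(L, R) = 0`. -/
theorem ext_eq_zero_of_finite_projective {L : ModuleCat.{u} R} {i : ℕ}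
    (h : Subsingleton (ExtDual R L i)) (P : ModuleCat.{u} R) [Module.Finite R P] [Projective P]
    (x : Ext.{u} L P i) : x = 0 := by
  obtain ⟨r, f, p, hfp⟩ := exists_dualBasis P
  rw [← Ext.comp_mk₀_id x, ← hfp, Ext.mk₀_sum, Ext.comp_sum]
  refine Finset.sum_eq_zero fun k _ => ?_
  rw [← Ext.mk₀_comp_mk₀, ← Ext.comp_assoc_of_third_deg_zero,
    Subsingleton.elim (α := ExtDual R L i) (x.comp (Ext.mk₀ (f k)) (add_zero i)) 0]
  exact Ext.zero_comp _ _ _ _ _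

/-- Over a left noetherian ring of finite global dimension, a finitely generated module `L` with
`Ext^i_R(L, R) = 0` for all `i` vanishes. -/
theorem isZero_of_subsingleton_extDual [IsNoetherianRing R] (hR : FiniteLeftGlobalDimension R)
    (L : ModuleCat.{u} R) [Module.Finite R L] (h : ∀ i, Subsingleton (ExtDual R L i)) :
    Limits.IsZero L := by
  obtain ⟨d, hd⟩ := hR
  have := (projectiveDimension_le_iff L d).1 (hd L)
  -- Descending induction on the degree: `Ext^i(L, X)` vanishes above `d`. Below that, with `0 → K →
  -- P → X → 0`, it sits between `Ext^i(L, P) = 0` and `Ext^{i+1}(L, K) = 0`. The number `c`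
  -- measures the distance to the bound. At the end `X = L` and `i = 0` give `𝟙 L = 0`.
  have key : ∀ (c i : ℕ), d < i + c → ∀ (X : ModuleCat.{u} R) [Module.Finite R X]
      (x : Ext.{u} L X i), x = 0 := by
    intro c
    induction c with
    | zero => exact fun i hi X _ x => x.eq_zero_of_hasProjectiveDimensionLT (d + 1) hi
    | succ c ih =>
      intro i hi X _ x
      obtain ⟨T, hT, rfl, _, _, _⟩ := exists_shortExact_finite_projective X
      obtain ⟨y, rfl⟩ := Ext.covariant_sequence_exact₃ L hT x rfl (ih (i + 1) (by lia) _ _)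
      rw [ext_eq_zero_of_finite_projective (h i) _ y, Ext.zero_comp]
  rw [Limits.IsZero.iff_id_eq_zero, ← Ext.mk₀_eq_zero_iff]
  exact key (d + 1) 0 (by lia) L _

end ModuleCat

/-! ### Vanishing of the higher `Tor` modules -/

namespace CategoryTheory.Functor

variable {C : Type*} [Category* C] [Abelian C] {D : Type*} [Category* D] [Abelian D]
  (F : C ⥤ D) [F.Additive] [Limits.PreservesFiniteColimits F]

theorem exact_map_of_shortExact {T : ShortComplex C} (hT : T.ShortExact) :
    (T.map F).Exact ∧ Epi (F.map T.g) :=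
  F.preservesFiniteColimits_iff_forall_exact_map_and_epi.1 ‹_› T hT

variable [EnoughProjectives C]

/-- The exact sequence `0 → L₁F(X₃) → F(X₁) → F(X₂) → F(X₃) → 0` for a short exact sequence with
projective middle term, cut into two short exact sequences. -/
theorem exists_shortExact_leftDerived_one {T : ShortComplex C} (hT : T.ShortExact)
    [Projective T.X₂] :
    ∃ (I : D) (a : (F.leftDerived 1).obj T.X₃ ⟶ F.obj T.X₁) (b : F.obj T.X₁ ⟶ I)
      (c : I ⟶ F.obj T.X₂) (w : a ≫ b = 0) (w' : c ≫ F.map T.g = 0),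
      (ShortComplex.mk a b w).ShortExact ∧ (ShortComplex.mk c (F.map T.g) w').ShortExact := by
  have hg := (F.exact_map_of_shortExact hT).2
  have hcg : Abelian.image.ι (F.map T.f) ≫ F.map T.g = 0 := by
    rw [← cancel_epi (Abelian.factorThruImage (F.map T.f)), ← Category.assoc, Abelian.image.fac,
      ← F.map_comp, T.zero, F.map_zero, Limits.comp_zero]
  have hab : ((F.leftDerivedOneIso hT).hom ≫ Limits.kernel.ι (F.map T.f)) ≫
      Abelian.factorThruImage (F.map T.f) = 0 := by
    rw [← cancel_mono (Abelian.image.ι (F.map T.f))]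
    simp
  refine ⟨Abelian.image (F.map T.f), (F.leftDerivedOneIso hT).hom ≫ Limits.kernel.ι (F.map T.f),
    Abelian.factorThruImage _, Abelian.image.ι _, hab, hcg, ?_, ?_⟩
  · refine ShortComplex.ShortExact.mk' ?_ (mono_comp _ _) inferInstance
    let φ : ShortComplex.mk _ _ hab ⟶ ShortComplex.mk _ _ (Limits.kernel.condition (F.map T.f)) :=
      { τ₁ := (F.leftDerivedOneIso hT).hom, τ₂ := 𝟙 _, τ₃ := Abelian.image.ι _ }
    have : Epi φ.τ₁ := inferInstanceAs (Epi (F.leftDerivedOneIso hT).hom)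
    have : IsIso φ.τ₂ := inferInstanceAs (IsIso (𝟙 _))
    have : Mono φ.τ₃ := inferInstanceAs (Mono (Abelian.image.ι _))
    exact (ShortComplex.exact_iff_of_epi_of_isIso_of_mono φ).2 (ShortComplex.exact_kernel _)
  · refine ShortComplex.ShortExact.mk' ?_ inferInstance hg
    let φ : T.map F ⟶ ShortComplex.mk _ _ hcg :=
      { τ₁ := Abelian.factorThruImage (F.map T.f)
        τ₂ := 𝟙 _
        τ₃ := 𝟙 _
        comm₁₂ := (Abelian.image.fac _).trans (Category.comp_id _).symm
        comm₂₃ := (Category.id_comp _).trans (Category.comp_id _).symm }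
    have : Epi φ.τ₁ := inferInstanceAs (Epi (Abelian.factorThruImage (F.map T.f)))
    have : IsIso φ.τ₂ := inferInstanceAs (IsIso (𝟙 _))
    have : Mono φ.τ₃ := inferInstanceAs (Mono (𝟙 _))
    exact (ShortComplex.exact_iff_of_epi_of_isIso_of_mono φ).1 (F.exact_map_of_shortExact hT).1

/-- The kernel of `F(T.f)` is `L₁F(X₃)`, the only obstruction to left exactness here. -/
theorem map_shortExact_of_isZero_leftDerived_one {T : ShortComplex C} (hT : T.ShortExact)
    [Projective T.X₂] (h : Limits.IsZero ((F.leftDerived 1).obj T.X₃)) : (T.map F).ShortExact :=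
  ShortComplex.ShortExact.mk' (F.exact_map_of_shortExact hT).1
    (Preadditive.mono_of_isZero_kernel _ (h.of_iso (F.leftDerivedOneIso hT).symm))
    (F.exact_map_of_shortExact hT).2

end CategoryTheory.Functor

section

variable {S A : Type u} [Ring S] [Ring A] {M : Type u} [AddCommGroup M] [Module S M]
  [Module Aᵐᵒᵖ M] [SMulCommClass S Aᵐᵒᵖ M] {m : ℕ}

/-- If `M` is `m`-Cohen-Macaulay over `S`, so is `M ⊗_A P` for `P` finitely generated projective. -/
theorem isCMOfGrade_bimoduleTensor (hM : IsCMOfGrade S M m) (P : ModuleCat.{u} A)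
    [Module.Finite A P] [Projective P] : IsCMOfGrade S ((bimoduleTensor S A M).obj P) m := by
  intro i hi
  have := ExtDual.subsingleton_of_iso (bimoduleTensorUnit S A M).symm (hM i hi)
  obtain ⟨r, f, p, hfp⟩ := ModuleCat.exists_dualBasis P
  refine subsingleton_of_forall_eq 0 fun x => ?_
  -- The identity of `M ⊗_A P` is a sum of maps through `M ⊗_A A ≅ M`, whose `Ext^i` is zero.
  rw [← ExtDual.precomp_id _ i x, ← (bimoduleTensor S A M).map_id, ← hfp, Functor.map_sum,
    ExtDual.precomp_sum]
  refine Finset.sum_eq_zero fun k _ => ?_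
  rw [Functor.map_comp, ExtDual.precomp_comp,
    Subsingleton.elim (ExtDual.precomp ((bimoduleTensor S A M).map (p k)) i x) 0, map_zero]

/-- If all `Tor_j^A(M, N)`, `j > 0`, have `Ext_S(-, S)` concentrated in the same degree
`q ≥ d + m`, and `Ext_S(M ⊗_A N, S)` vanishes above `q`, then the higher `Tor` vanish. -/
theorem isZero_leftDerived_bimoduleTensor [IsNoetherianRing A] [IsNoetherianRing S]
    (hS : FiniteLeftGlobalDimension S) [Module.Finite S M] (hM : IsCMOfGrade S M m) {q : ℕ} (d : ℕ)
    (hd : d + m ≤ q) (N : ModuleCat.{u} A) [Module.Finite A N] [HasProjectiveDimensionLE N d]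
    (hTor : ∀ j, IsCMOfGrade S (((bimoduleTensor S A M).leftDerived (j + 1)).obj N) q)
    (hN : ∀ i, q < i → Subsingleton (ExtDual S ((bimoduleTensor S A M).obj N) i)) :
    (∀ j, Limits.IsZero (((bimoduleTensor S A M).leftDerived (j + 1)).obj N)) ∧
      ∀ i, d + m < i → Subsingleton (ExtDual S ((bimoduleTensor S A M).obj N) i) := by
  induction d generalizing N with
  | zero =>
    have : Projective N := (projective_iff_hasProjectiveDimensionLE_zero N).2 ‹_›
    exact ⟨fun j => Functor.isZero_leftDerived_obj_projective_succ _ j N,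
      fun i hi => isCMOfGrade_bimoduleTensor hM N i (by lia)⟩
  | succ d ih =>
    obtain ⟨T, hT, rfl, _, _, _⟩ := ModuleCat.exists_shortExact_finite_projective N
    have hpd : HasProjectiveDimensionLE T.X₁ d :=
      (hT.hasProjectiveDimensionLT_X₃_iff d ‹_›).1 ‹_›
    obtain ⟨I, a, b, c, w, w', hab, hc⟩ :=
      (bimoduleTensor S A M).exists_shortExact_leftDerived_one hT
    have hP := isCMOfGrade_bimoduleTensor hM T.X₂
    -- The inequality `d + 1 + m ≤ q` gives `m < q`, so `Ext^i(M ⊗ T.X₂)` vanishes from degree `q`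
    -- on, and `Ext^{i+1}(M ⊗ T.X₃)` vanishes by `hN`.
    have hI : ∀ i, q ≤ i → Subsingleton (ExtDual S I i) := fun i hi =>
      ExtDual.subsingleton_X₁ hc (hP i (by lia)) (hN (i + 1) (by lia))
    -- Same `q`, smaller `d`. The sharper bound `hK'`, vanishing above `d + m` and not merely above
    -- `q`, is what reaches degree `q` below.
    obtain ⟨hK, hK'⟩ := ih (by lia) T.X₁
      (fun j i hi => ExtDual.subsingleton_of_iso
        ((bimoduleTensor S A M).leftDerivedShiftIso hT j) (hTor (j + 1) i hi))
      (fun i hi => ExtDual.subsingleton_X₂ hab (hTor 0 i (by lia)) (hI i (by lia)))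
    have hzero : Limits.IsZero (((bimoduleTensor S A M).leftDerived 1).obj T.X₃) := by
      have := bimoduleTensor_finite S A M T.X₁
      have : Module.Finite S (((bimoduleTensor S A M).leftDerived 1).obj T.X₃) :=
        Module.Finite.of_injective a.hom hab.moduleCat_injective_f
      refine ModuleCat.isZero_of_subsingleton_extDual hS _ fun i => ?_
      by_cases hi : i = q
      · subst hi
        exact ExtDual.subsingleton_X₁ hab (hK' i (by lia)) (hI _ (by lia))
      · exact hTor 0 i hi
    refine ⟨fun j => ?_, fun i hi => ?_⟩
    · match j with
      | 0 => exact hzero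
      | j + 1 => exact (hK j).of_iso ((bimoduleTensor S A M).leftDerivedShiftIso hT j)
    · obtain _ | i := i
      · lia
      · exact ExtDual.subsingleton_X₃
          ((bimoduleTensor S A M).map_shortExact_of_isZero_leftDerived_one hT hzero)
          (hK' i (by lia)) (hP _ (by lia))

end

/-! ### Duality for finitely generated projective modules -/

namespace ExtDual

variable {R : Type u} [Ring R]

/-- `Ext^0_R(X, R)` is `Hom_R(X, R)`. -/
noncomputable def homEquiv (X : ModuleCat.{u} R) : ExtDual R X 0 ≃+ (X ⟶ ModuleCat.of R R) :=
  Ext.addEquiv₀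

theorem homEquiv_symm_precomp {X Y : ModuleCat.{u} R} (g : X ⟶ Y) (f : Y ⟶ ModuleCat.of R R) :
    precomp g 0 ((homEquiv Y).symm f) = (homEquiv X).symm (g ≫ f) :=
  Ext.mk₀_comp_mk₀ g f

theorem homEquiv_symm_smul {X : ModuleCat.{u} R} (r : Rᵐᵒᵖ) (f : X ⟶ ModuleCat.of R R) :
    r • (homEquiv X).symm f = (homEquiv X).symm (f ≫ smulHom R R r) :=
  Ext.mk₀_comp_mk₀ f (smulHom R R r)

theorem homEquiv_precomp {X Y : ModuleCat.{u} R} (g : X ⟶ Y) (x : ExtDual R Y 0) :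
    homEquiv X (precomp g 0 x) = g ≫ homEquiv Y x := by
  rw [← AddEquiv.eq_symm_apply, ← homEquiv_symm_precomp, AddEquiv.symm_apply_apply]

theorem homEquiv_smul {X : ModuleCat.{u} R} (r : Rᵐᵒᵖ) (x : ExtDual R X 0) :
    homEquiv X (r • x) = homEquiv X x ≫ smulHom R R r := by
  rw [← AddEquiv.eq_symm_apply, ← homEquiv_symm_smul, AddEquiv.symm_apply_apply]

end ExtDual

section

variable (S : Type u) {A : Type u} [Ring S] [Ring A] (M : Type u) [AddCommGroup M] [Module S M]
  [Module Aᵐᵒᵖ M] [SMulCommClass S Aᵐᵒᵖ M] (m : ℕ)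

attribute [local instance] BalancedTensor.rightModule

/-- The map `Ext^m_S(M, S) → Ext^m_S(M ⊗_A N, S)` induced by an `A`-linear map `N → A`. -/
noncomputable def extPullback {N : ModuleCat.{u} A} (h : N ⟶ ModuleCat.of A A) :
    ExtDual S M m →ₗ[Sᵐᵒᵖ] ExtDual S ((bimoduleTensor S A M).obj N) m :=
  ExtDual.precomp ((bimoduleTensor S A M).map h ≫ (bimoduleTensorUnit S A M).hom) m

/-- The map `Ext^m_S(M ⊗_A N, S) → Ext^m_S(M, S)` induced by an `A`-linear map `A → N`. -/
noncomputable def extEvaluate {N : ModuleCat.{u} A} (p : ModuleCat.of A A ⟶ N) :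
    ExtDual S ((bimoduleTensor S A M).obj N) m →ₗ[Sᵐᵒᵖ] ExtDual S M m :=
  ExtDual.precomp ((bimoduleTensorUnit S A M).inv ≫ (bimoduleTensor S A M).map p) m

variable {S M m}

theorem extPullback_add {N : ModuleCat.{u} A} (h h' : N ⟶ ModuleCat.of A A) (e : ExtDual S M m) :
    extPullback S M m (h + h') e = extPullback S M m h e + extPullback S M m h' e := by
  have := ExtDual.precomp_add ((bimoduleTensor S A M).map h ≫ (bimoduleTensorUnit S A M).hom)
    ((bimoduleTensor S A M).map h' ≫ (bimoduleTensorUnit S A M).hom) m e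
  rwa [← Preadditive.add_comp, ← Functor.map_add] at this

theorem precomp_extPullback {N N' : ModuleCat.{u} A} (g : N ⟶ N') (h : N' ⟶ ModuleCat.of A A)
    (e : ExtDual S M m) :
    ExtDual.precomp ((bimoduleTensor S A M).map g) m (extPullback S M m h e) =
      extPullback S M m (g ≫ h) e := by
  have := ExtDual.precomp_comp ((bimoduleTensor S A M).map g)
    ((bimoduleTensor S A M).map h ≫ (bimoduleTensorUnit S A M).hom) m e
  rw [← Functor.map_comp_assoc] at this
  exact this.symm

/-- This is the balancedness needed to define `homTensorExt`: right multiplication on `A` becomes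
right multiplication on `M`, which is what defines the left `A`-action on `Ext^m_S(M, S)`. -/
theorem extPullback_comp_smulHom {N : ModuleCat.{u} A} (h : N ⟶ ModuleCat.of A A) (a : A)
    (e : ExtDual S M m) :
    extPullback S M m (h ≫ ExtDual.smulHom A A (op a)) e = extPullback S M m h (a • e) := by
  have : SMulCommClass Aᵐᵒᵖ S M := SMulCommClass.symm _ _ _
  have := ExtDual.precomp_comp ((bimoduleTensor S A M).map h ≫ (bimoduleTensorUnit S A M).hom)
    (ExtDual.smulHom S M (op a)) m e
  rw [Category.assoc, ← bimoduleTensorUnit_naturality, ← Functor.map_comp_assoc] at this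
  exact this

theorem extPullback_extEvaluate {N N' : ModuleCat.{u} A} (f : N' ⟶ ModuleCat.of A A)
    (p : ModuleCat.of A A ⟶ N) (x : ExtDual S ((bimoduleTensor S A M).obj N) m) :
    extPullback S M m f (extEvaluate S M m p x) =
      ExtDual.precomp ((bimoduleTensor S A M).map (f ≫ p)) m x := by
  have := ExtDual.precomp_comp ((bimoduleTensor S A M).map f ≫ (bimoduleTensorUnit S A M).hom)
    ((bimoduleTensorUnit S A M).inv ≫ (bimoduleTensor S A M).map p) m x
  rw [Category.assoc, Iso.hom_inv_id_assoc, ← Functor.map_comp] at this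
  exact this.symm

theorem extEvaluate_extPullback {N : ModuleCat.{u} A} (p : ModuleCat.of A A ⟶ N)
    (h : N ⟶ ModuleCat.of A A) {a : A} (ha : p ≫ h = ExtDual.smulHom A A (op a))
    (e : ExtDual S M m) : extEvaluate S M m p (extPullback S M m h e) = a • e := by
  have : SMulCommClass Aᵐᵒᵖ S M := SMulCommClass.symm _ _ _
  have := ExtDual.precomp_comp ((bimoduleTensorUnit S A M).inv ≫ (bimoduleTensor S A M).map p)
    ((bimoduleTensor S A M).map h ≫ (bimoduleTensorUnit S A M).hom) m e
  rw [Category.assoc, ← Functor.map_comp_assoc, ha, bimoduleTensorUnit_naturality,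
    Iso.inv_hom_id_assoc] at this
  exact this.symm

variable (S M m)

/-- The natural map `Hom_A(N, A) ⊗_A Ext^m_S(M, S) → Ext^m_S(M ⊗_A N, S)`. -/
noncomputable def homTensorExt (N : ModuleCat.{u} A) :
    BalancedTensor A (ExtDual A N 0) (ExtDual S M m) →ₗ[Sᵐᵒᵖ]
      ExtDual S ((bimoduleTensor S A M).obj N) m :=
  letI φ : ExtDual A N 0 →+ ExtDual S M m →+ ExtDual S ((bimoduleTensor S A M).obj N) m :=
    AddMonoidHom.mk' (fun f => (extPullback S M m (ExtDual.homEquiv N f)).toAddMonoidHom)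
      fun f g => AddMonoidHom.ext fun e => by
        simpa using extPullback_add (ExtDual.homEquiv N f) (ExtDual.homEquiv N g) e
  letI ψ := BalancedTensor.lift (A := A) φ fun f a e =>
    (congrArg (fun h => extPullback S M m h e) (ExtDual.homEquiv_smul (op a) f)).trans
      (extPullback_comp_smulHom _ a e)
  { toFun := ψ
    map_add' := ψ.map_add
    map_smul' := fun r z => by
      induction z using BalancedTensor.induction with
      | h0 => rw [smul_zero, ψ.map_zero, smul_zero]
      | ht f e => exact (extPullback S M m (ExtDual.homEquiv N f)).map_smul r e
      | ha z w hz hw => rw [smul_add, ψ.map_add, hz, hw, ψ.map_add, smul_add] }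

@[simp]
theorem homTensorExt_tmul (N : ModuleCat.{u} A) (f : ExtDual A N 0) (e : ExtDual S M m) :
    homTensorExt S M m N (BalancedTensor.tmul A f e) =
      extPullback S M m (ExtDual.homEquiv N f) e :=
  rfl

theorem homTensorExt_naturality {N N' : ModuleCat.{u} A} (g : N ⟶ N')
    (z : BalancedTensor A (ExtDual A N' 0) (ExtDual S M m)) :
    homTensorExt S M m N (BalancedTensor.map (ExtDual.precomp g 0) LinearMap.id z) =
      ExtDual.precomp ((bimoduleTensor S A M).map g) m (homTensorExt S M m N' z) := by
  induction z using BalancedTensor.induction with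
  | h0 => simp only [map_zero]
  | ht f e =>
    rw [BalancedTensor.map_tmul, homTensorExt_tmul, homTensorExt_tmul, precomp_extPullback,
      ExtDual.homEquiv_precomp, LinearMap.id_apply]
  | ha z w hz hw => simp only [map_add, hz, hw]

/-- A dual basis `(f_k, p_k)` of `P` gives the explicit inverse `x ↦ ∑ f_k ⊗ p_k^*(x)`, where
`p_k^*` is `extEvaluate`. -/
theorem homTensorExt_bijective (P : ModuleCat.{u} A) [Module.Finite A P] [Projective P] :
    Function.Bijective (homTensorExt S M m P) := by
  obtain ⟨r, f, p, hfp⟩ := ModuleCat.exists_dualBasis P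
  let ψ : ExtDual S ((bimoduleTensor S A M).obj P) m →+
      BalancedTensor A (ExtDual A P 0) (ExtDual S M m) :=
    AddMonoidHom.mk' (fun x => ∑ k, BalancedTensor.tmul A ((ExtDual.homEquiv P).symm (f k))
      (extEvaluate S M m (p k) x)) fun x y => by
      simp only [map_add, BalancedTensor.tmul_add, Finset.sum_add_distrib]
  have hψ : ∀ x, ψ x = ∑ k, BalancedTensor.tmul A ((ExtDual.homEquiv P).symm (f k))
      (extEvaluate S M m (p k) x) := fun _ => rfl
  refine Function.bijective_iff_has_inverse.2 ⟨ψ, fun z => ?_, fun x => ?_⟩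
  · induction z using BalancedTensor.induction with
    | h0 => simp only [map_zero]
    | ht h e =>
      obtain ⟨h, rfl⟩ := (ExtDual.homEquiv P).symm.surjective h
      have key : ∀ k, BalancedTensor.tmul A ((ExtDual.homEquiv P).symm (f k))
          (extEvaluate S M m (p k) (homTensorExt S M m P
            (BalancedTensor.tmul A ((ExtDual.homEquiv P).symm h) e))) =
          BalancedTensor.tmul A ((ExtDual.homEquiv P).symm ((f k ≫ p k) ≫ h)) e := by
        intro k
        -- A left `A`-linear endomorphism of `A` is right multiplication by the image of `1`. This
        -- scalar is then moved across the tensor sign, from `e` onto `f k`.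
        have hc : p k ≫ h = ExtDual.smulHom A A (op (h.hom ((p k).hom (1 : A)))) := by
          ext
          simp [ExtDual.smulHom]
        rw [Category.assoc, hc, ← ExtDual.homEquiv_symm_smul, BalancedTensor.op_smul_tmul,
          homTensorExt_tmul, AddEquiv.apply_symm_apply, extEvaluate_extPullback _ _ hc]
      rw [hψ, Finset.sum_congr rfl fun k _ => key k]
      let τ : ExtDual A P 0 →+ BalancedTensor A (ExtDual A P 0) (ExtDual S M m) :=
        AddMonoidHom.mk' (fun g => BalancedTensor.tmul A g e) fun _ _ =>
          BalancedTensor.add_tmul _ _ _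
      change ∑ k, τ ((ExtDual.homEquiv P).symm ((f k ≫ p k) ≫ h)) = τ ((ExtDual.homEquiv P).symm h)
      rw [← map_sum, ← map_sum, ← Preadditive.sum_comp, hfp, Category.id_comp]
    | ha z w hz hw => rw [map_add, map_add, hz, hw]
  · rw [hψ, map_sum]
    simp only [homTensorExt_tmul, AddEquiv.apply_symm_apply, extPullback_extEvaluate]
    rw [← ExtDual.precomp_sum, ← Functor.map_sum, hfp, CategoryTheory.Functor.map_id,
      ExtDual.precomp_id]

end

/-! ### The dual of the tensor product -/

namespace BalancedTensor

variable (T : Type*) [Ring T] {A : Type*} [Ring A] {M M' : Type*} [AddCommGroup M] [Module Aᵐᵒᵖ M]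
  [AddCommGroup M'] [Module Aᵐᵒᵖ M'] (N : Type*) [AddCommGroup N] [Module A N] [Module T N]
  [SMulCommClass T A N]

attribute [local instance] BalancedTensor.rightModule

/-- The map `f ⊗ id`, linear for an action on the second factor. -/
noncomputable def mapLeft (f : M →ₗ[Aᵐᵒᵖ] M') :
    BalancedTensor A M N →ₗ[T] BalancedTensor A M' N where
  toFun := map f LinearMap.id
  map_add' := _root_.map_add _
  map_smul' t z := by
    change map f LinearMap.id (map LinearMap.id (DistribSMul.toLinearMap A N t) z) =
      map LinearMap.id (DistribSMul.toLinearMap A N t) (map f LinearMap.id z)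
    rw [map_comp_apply, map_comp_apply]
    rfl

/-- The isomorphism `f ⊗ id`, linear for an action on the second factor. -/
noncomputable def congrLeft (f : M ≃ₗ[Aᵐᵒᵖ] M') :
    BalancedTensor A M N ≃ₗ[T] BalancedTensor A M' N :=
  { mapLeft T N f.toLinearMap with
    invFun := map f.symm.toLinearMap LinearMap.id
    left_inv := fun z => by
      change map _ _ (map _ _ z) = z
      rw [map_comp_apply, LinearMap.id_comp, LinearEquiv.symm_comp, map_id]
      rfl
    right_inv := fun z => by
      change map _ _ (map _ _ z) = z
      rw [map_comp_apply, LinearMap.id_comp, LinearEquiv.comp_symm, map_id]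
      rfl }

end BalancedTensor

theorem ExtDual.subsingleton_of_projective {R : Type u} [Ring R] (P : ModuleCat.{u} R)
    [Projective P] {i : ℕ} (hi : 0 < i) : Subsingleton (ExtDual R P i) := by
  obtain ⟨i, rfl⟩ := Nat.exists_eq_succ_of_ne_zero hi.ne'
  exact subsingleton_of_forall_eq 0 fun x =>
    Ext.eq_zero_of_projective (x : Ext.{u} P (ModuleCat.of R R) (i + 1))

section

variable {S A : Type u} [Ring S] [Ring A] {M : Type u} [AddCommGroup M] [Module S M]
  [Module Aᵐᵒᵖ M] [SMulCommClass S Aᵐᵒᵖ M] {m : ℕ}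

attribute [local instance] BalancedTensor.rightModule

/-- The case of a short exact sequence of finitely generated modules with projective first two
terms. -/
theorem nonempty_equiv_tensor_of_shortExact (hM : IsCMOfGrade S M m)
    {T : ShortComplex (ModuleCat.{u} A)} (hT : T.ShortExact)
    [Module.Finite A T.X₁] [Module.Finite A T.X₂] [Projective T.X₁] [Projective T.X₂]
    (hF : (T.map (bimoduleTensor S A M)).ShortExact) :
    Nonempty (ExtDual S ((bimoduleTensor S A M).obj T.X₃) (1 + m) ≃ₗ[Sᵐᵒᵖ]
      BalancedTensor A (ExtDual A T.X₃ 1) (ExtDual S M m)) := by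
  let δ := ExtDual.connecting hT (i := 0) (j := 1) rfl
  have hδ : Function.Surjective δ :=
    ExtDual.connecting_surjective hT rfl (ExtDual.subsingleton_of_projective T.X₂ one_pos)
  let δ' : ExtDual S ((bimoduleTensor S A M).obj T.X₁) m →ₗ[Sᵐᵒᵖ]
      ExtDual S ((bimoduleTensor S A M).obj T.X₃) (1 + m) := ExtDual.connecting hF rfl
  have hδ' : Function.Surjective δ' :=
    ExtDual.connecting_surjective hF rfl (isCMOfGrade_bimoduleTensor hM T.X₂ _ (by lia))
  have hex' : Function.Exact (ExtDual.precomp ((bimoduleTensor S A M).map T.f) m) δ' :=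
    ExtDual.exact_precomp_connecting hF rfl
  have hΦ₁ := homTensorExt_bijective S M m T.X₁
  have hΦ₂ := homTensorExt_bijective S M m T.X₂
  let g₁ := δ' ∘ₗ homTensorExt S M m T.X₁
  let g₂ := BalancedTensor.mapLeft Sᵐᵒᵖ (ExtDual S M m) δ
  -- Both maps are surjections from `Hom_A(T.X₁, A) ⊗ Ext^m_S(M, S)`. The naturality square, with
  -- bijective comparison maps for `T.X₁` and `T.X₂`, identifies both kernels with the image of
  -- `Hom_A(T.X₂, A) ⊗ Ext^m_S(M, S)`.
  have hker : LinearMap.ker g₁ = LinearMap.ker g₂ := by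
    ext z
    have h₂ : g₂ z = 0 ↔ _ :=
      BalancedTensor.map_left_exact (ExtDual.exact_precomp_connecting hT rfl) hδ z
    rw [LinearMap.mem_ker, LinearMap.mem_ker, h₂]
    refine (hex' (homTensorExt S M m T.X₁ z)).trans ⟨?_, ?_⟩
    · rintro ⟨y, hy⟩
      obtain ⟨y, rfl⟩ := hΦ₂.2 y
      exact ⟨y, hΦ₁.1 ((homTensorExt_naturality S M m T.f y).trans hy)⟩
    · rintro ⟨y, rfl⟩
      exact ⟨_, (homTensorExt_naturality S M m T.f y).symm⟩
  exact ⟨(g₁.quotKerEquivOfSurjective (hδ'.comp hΦ₁.2)).symm ≪≫ₗ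
    Submodule.quotEquivOfEq _ _ hker ≪≫ₗ g₂.quotKerEquivOfSurjective (BalancedTensor.map_left_surjective hδ)⟩

/-- If `Tor_j^A(M, N) = 0` for `j > 0` and `N` has projective dimension at most `d`, then
`Ext^{d+m}_S(M ⊗_A N, S) ≅ Ext^d_A(N, A) ⊗_A Ext^m_S(M, S)`. -/
theorem nonempty_equiv_tensor_of_isZero_leftDerived [IsNoetherianRing A]
    (hM : IsCMOfGrade S M m) (d : ℕ) (N : ModuleCat.{u} A) [Module.Finite A N]
    [HasProjectiveDimensionLE N d]
    (hTor : ∀ j, Limits.IsZero (((bimoduleTensor S A M).leftDerived (j + 1)).obj N)) :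
    Nonempty (ExtDual S ((bimoduleTensor S A M).obj N) (d + m) ≃ₗ[Sᵐᵒᵖ]
      BalancedTensor A (ExtDual A N d) (ExtDual S M m)) := by
  induction d generalizing N with
  | zero =>
    have : Projective N := (projective_iff_hasProjectiveDimensionLE_zero N).2 ‹_›
    rw [zero_add]
    exact ⟨(LinearEquiv.ofBijective _ (homTensorExt_bijective S M m N)).symm⟩
  | succ d ih =>
    obtain ⟨T, hT, rfl, _, _, _⟩ := ModuleCat.exists_shortExact_finite_projective N
    have hpd : HasProjectiveDimensionLE T.X₁ d :=
      (hT.hasProjectiveDimensionLT_X₃_iff d ‹_›).1 ‹_›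
    have hF := (bimoduleTensor S A M).map_shortExact_of_isZero_leftDerived_one hT (hTor 0)
    -- For `d = 0` the connecting maps need not be injective, since `Hom_A(T.X₂, A)` and `Ext^m_S(M
    -- ⊗ T.X₂, S)` may be nonzero; for `d > 0` they are isomorphisms on both sides.
    obtain rfl | hd := Nat.eq_zero_or_pos d
    · have : Projective T.X₁ := (projective_iff_hasProjectiveDimensionLE_zero _).2 hpd
      exact nonempty_equiv_tensor_of_shortExact hM hT hF
    · have hP := isCMOfGrade_bimoduleTensor hM T.X₂
      obtain ⟨e⟩ := ih T.X₁ fun j =>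
        (hTor (j + 1)).of_iso ((bimoduleTensor S A M).leftDerivedShiftIso hT j).symm
      let e₁ : ExtDual A T.X₁ d ≃ₗ[Aᵐᵒᵖ] ExtDual A T.X₃ (d + 1) :=
        LinearEquiv.ofBijective (ExtDual.connecting hT (add_comm 1 d))
          ⟨ExtDual.connecting_injective hT _ (ExtDual.subsingleton_of_projective _ hd),
            ExtDual.connecting_surjective hT _ (ExtDual.subsingleton_of_projective _ d.succ_pos)⟩
      let e₂ : ExtDual S ((bimoduleTensor S A M).obj T.X₁) (d + m) ≃ₗ[Sᵐᵒᵖ]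
          ExtDual S ((bimoduleTensor S A M).obj T.X₃) (d + 1 + m) :=
        LinearEquiv.ofBijective (ExtDual.connecting hF (by lia))
          ⟨ExtDual.connecting_injective hF _ (hP _ (by lia)),
            ExtDual.connecting_surjective hF _ (hP _ (by lia))⟩
      exact ⟨e₂.symm ≪≫ₗ e ≪≫ₗ BalancedTensor.congrLeft Sᵐᵒᵖ (ExtDual S M m) e₁⟩

end

end

theorem mainTheorem10 (k : Type v) [Field k]
    (S A : Type u) [Ring S] [Algebra k S] [Ring A] [Algebra k A]
    (hS : IsAuslanderRegular S) (hS' : IsCMAlgebra k S)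
    (hA : IsAuslanderGorenstein A) (hA' : IsCMAlgebra k A)
    (n m : ℕ)
    (N : Type u) [AddCommGroup N] [Module A N] [Module.Finite A N]
    (hN : ∃ p : ℕ, IsCMOfGrade A N p)
    (hpd : projectiveDimension (ModuleCat.of A N) = (n : WithBot ℕ∞))
    (M : Type u) [AddCommGroup M] [Module S M] [Module Aᵐᵒᵖ M] [SMulCommClass S Aᵐᵒᵖ M]
    [Module.Finite S M]
    (hM : IsCMOfGrade S M m)
    (hvan : ∀ i j : ℕ, i ≠ n + m → Subsingleton (ExtDual S (bimoduleTor S A M j N) i)) :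
    -- `M ⊗_A N` is a left `S`-module through `M`, and `Ext^n_A(N, A) ⊗_A Ext^m_S(M, S)` is a right
    -- `S`-module through `Ext^m_S(M, S)`.
    letI := BalancedTensor.leftModule S A M N
    letI := BalancedTensor.rightModule Sᵐᵒᵖ A (ExtDual A N n) (ExtDual S M m)
    Nonempty (ExtDual S (BalancedTensor A M N) (n + m) ≃ₗ[Sᵐᵒᵖ]
      BalancedTensor A (ExtDual A N n) (ExtDual S M m)) ∧
    ∀ i : ℕ, 0 < i → Subsingleton (bimoduleTor S A M i N) := by
  have := hS.noetherian_left
  have := hA.noetherian_left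
  have := (projectiveDimension_le_iff (ModuleCat.of A N) n).1 hpd.le
  -- The induction starts at `d = n` and `q = n + m`, so the required inequality is an equality. The
  -- case `j = 0` of `hvan` is carried to `M ⊗_A N` along `L₀F ≅ F`.
  have hTor := (isZero_leftDerived_bimoduleTensor hS.gldim_left hM n le_rfl (ModuleCat.of A N)
    (fun j i hi => hvan i (j + 1) hi) fun i hi => ExtDual.subsingleton_of_iso
      ((bimoduleTensor S A M).leftDerivedZeroIsoSelf.app _) (hvan i 0 hi.ne')).1
  refine ⟨nonempty_equiv_tensor_of_isZero_leftDerived hM n (ModuleCat.of A N) hTor, fun i hi => ?_⟩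
  obtain ⟨j, rfl⟩ := Nat.exists_eq_succ_of_ne_zero hi.ne'
  exact ModuleCat.subsingleton_of_isZero (hTor j)
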